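/- **Theorem.** Let $m\ge 2$, let $D\subset\mathbb{R}^m$ be a bounded domain (a non-empty, open, connected, bounded set) and let $\lambda>0$. Let $J_\nu$ denote the Bessel function of the first kind of order $\nu$, let $j_{\nu,1}$ be its first positive zero, and put, for $t>0$, $$a^\circ(t)=\Gamma\!\left(\tfrac m2\right)\frac{J_{(m-2)/2}(t)}{(t/2)^{(m-2)/2}},\qquad a^\bullet(t)=\Gamma\!\left(\tfrac m2+1\right)\frac{J_{m/2}(t)}{(t/2)^{m/2}} .$$ Write $B_r(x)=\{y:|y-x|<r\}$, $S_r(x)=\partial B_r(x)$, $A_x(r_1,r_2)=\{y: r_1<|x-y|<r_2\}$, let $|\cdot|$ denote volume, and let $$M^\bullet(D',u)=\frac1{|D'|}\int_{D'}u(y)\,\mathrm{d}y,\qquad M^\circ(S_r(x),u)=\frac1{\omega_m}\int_{S_1(0)}u(x+ry)\,\mathrm{d}S_y$$ be the volume mean and the spherical mean, where $\mathrm{d}S$ is surface measure and $\omega_m=2\pi^{m/2}/\Gamma(m/2)$ is the area of the unit sphere. Let $u:D\to\mathbb{R}$ be continuous. Suppose that for every $x\in D$ and all $r_1,r_2$ with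 $0<r_1<r_2<j_{(m-2)/2,1}/\lambda$ and $\overline{B_{r_2}(x)}\subset D$, the identity $$M^\bullet(A_x(r_1,r_2),u)=\frac{a^\bullet(\lambda r_2)\,|B_{r_2}(x)|-a^\bullet(\lambda r_1)\,|B_{r_1}(x)|}{a^\circ(\lambda r)\,|A_x(r_1,r_2)|}\,M^\circ(S_r(x),u)$$ holds either for every $r\in(r_1,r_2)$, or for $r=r_1$, or for $r=r_2$. Then $u$ is metaharmonic in $D$: $u\in C^2(D)$ and $\Delta u+\lambda^2u=0$ in $D$. -/

import Mathlib

open MeasureTheory Metric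
open scoped InnerProductSpace

noncomputable section

namespace Metaharmonic

/-- The Bessel function of the first kind `J_ν`, by its power series (used for `ν ≥ 0`, `t > 0`). -/
def besselJ (ν t : ℝ) : ℝ :=
  ∑' k : ℕ, (-1) ^ k / ((k.factorial : ℝ) * Real.Gamma (k + ν + 1)) * (t / 2) ^ (2 * (k : ℝ) + ν)

/-- The first positive zero `j_{ν,1}` of `J_ν`. -/
def besselFirstZero (ν : ℝ) : ℝ :=
  sInf {t : ℝ | 0 < t ∧ besselJ ν t = 0}

/-- The coefficient `a°(t) = Γ(m/2) J_{(m-2)/2}(t) / (t/2)^{(m-2)/2}` of the spherical mean. -/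
def aSphere (m : ℕ) (t : ℝ) : ℝ :=
  Real.Gamma ((m : ℝ) / 2) * besselJ (((m : ℝ) - 2) / 2) t / (t / 2) ^ (((m : ℝ) - 2) / 2)

/-- The coefficient `a•(t) = Γ(m/2 + 1) J_{m/2}(t) / (t/2)^{m/2}` of the volume mean. -/
def aBall (m : ℕ) (t : ℝ) : ℝ :=
  Real.Gamma ((m : ℝ) / 2 + 1) * besselJ ((m : ℝ) / 2) t / (t / 2) ^ ((m : ℝ) / 2)

/-- The open annulus `A_x(r₁, r₂)`. -/
def annulus {m : ℕ} (x : EuclideanSpace ℝ (Fin m)) (r₁ r₂ : ℝ) : Set (EuclideanSpace ℝ (Fin m)) :=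
  {y | r₁ < dist x y ∧ dist x y < r₂}

/-- The volume mean `M•(D', u)`: the integral over `D'` divided by the volume of `D'`. -/
def volumeMean {m : ℕ} (D' : Set (EuclideanSpace ℝ (Fin m))) (u : EuclideanSpace ℝ (Fin m) → ℝ) :
    ℝ :=
  (volume.real D')⁻¹ * ∫ y in D', u y

/-- The spherical mean `M°(S_r(x), u) = (1/ω_m) ∫_{S_1(0)} u(x + r y) dS_y`, where `dS` is the
surface measure of the unit sphere and `ω_m` is its total mass. -/
def sphericalMean {m : ℕ} (x : EuclideanSpace ℝ (Fin m)) (r : ℝ)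
    (u : EuclideanSpace ℝ (Fin m) → ℝ) : ℝ :=
  ((volume : Measure (EuclideanSpace ℝ (Fin m))).toSphere.real Set.univ)⁻¹ *
    ∫ y : sphere (0 : EuclideanSpace ℝ (Fin m)) 1,
      u (x + r • (y : EuclideanSpace ℝ (Fin m))) ∂(volume.toSphere)

/-- The annular quadrature identity with centre `x`, annulus radii `r₁, r₂` and sphere radius `r`. -/
def AnnularIdentity {m : ℕ} (lam : ℝ) (u : EuclideanSpace ℝ (Fin m) → ℝ)
    (x : EuclideanSpace ℝ (Fin m)) (r₁ r₂ r : ℝ) : Prop :=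
  volumeMean (annulus x r₁ r₂) u =
    (aBall m (lam * r₂) * volume.real (ball x r₂) - aBall m (lam * r₁) * volume.real (ball x r₁)) /
      (aSphere m (lam * r) * volume.real (annulus x r₁ r₂)) * sphericalMean x r u

/-- `u` is metaharmonic in the open set `D`: a `C²` solution of `Δu + λ²u = 0` in `D`. -/
def IsMetaharmonicOn {m : ℕ} (lam : ℝ) (u : EuclideanSpace ℝ (Fin m) → ℝ)
    (D : Set (EuclideanSpace ℝ (Fin m))) : Prop :=
  ContDiffOn ℝ 2 u D ∧ ∀ x ∈ D, Laplacian.laplacian u x + lam ^ 2 * u x = 0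

end Metaharmonic

end

/-! Fix a centre `x` and put `A s = sphereCoeff m (lam * s)`, the function `a°(λs)`. Since `(t^m
a•(t))' = m t^(m-1) a°(t)`, polar coordinates turn both sides of the annular identity into integrals
over `[r₁, r₂]`: it says that `g = sphericalMean x · u / A`, averaged against the weight `s^(m-1) A
s`, has mean `g r` (`AnnularIdentity.integral_eq`). Below `j/λ` the weight is positive. If the mean
over every interval is attained at an endpoint, `g` is constant
(`eqOn_const_of_weighted_mean_endpoint`): otherwise some interval has all interior values strictly
between the endpoint values, and so is the mean. The case of all intermediate `r` reduces to an
endpoint by continuity. As `s → 0` the constant is `u x`, which gives the mean value formula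
`sphericalMean x r u = u x * A r`.

The formula makes convolution with a small radial bump multiply `u` by a positive constant, so `u`
is smooth (`contDiffAt_of_sphericalMean`). Integrating the second order Taylor expansion over a
small ball and comparing with the expansion of `a•` at `0` gives the equation
(`laplacian_add_eq_zero_of_sphericalMean`). -/

namespace Metaharmonic

open MeasureTheory Metric Set Filter Topology

/-! ### Power series of the Bessel coefficients and their derivatives. -/

section BesselSeries

/-- The coefficients of the entire function `besselEntire μ`. -/
noncomputable def besselCoeff (μ : ℝ) (k : ℕ) : ℝ :=
  1 / ((k.factorial : ℝ) * Real.Gamma (k + μ))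

/-- The entire function `x ↦ ∑ (-x)^k / (k! Γ(k + μ))`, which satisfies
`J_ν(t) = (t/2)^ν * besselEntire (ν + 1) (t²/4)`. -/
noncomputable def besselEntire (μ x : ℝ) : ℝ :=
  ∑' k : ℕ, (-1) ^ k * besselCoeff μ k * x ^ k

lemma besselCoeff_pos {μ : ℝ} (hμ : 0 < μ) (k : ℕ) : 0 < besselCoeff μ k := by
  have := Real.Gamma_pos_of_pos (show 0 < (k : ℝ) + μ by positivity)
  unfold besselCoeff
  positivity

lemma besselCoeff_succ (μ : ℝ) (k : ℕ) :
    besselCoeff μ (k + 1) * (k + 1 : ℕ) = besselCoeff (μ + 1) k := by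
  unfold besselCoeff
  have h : ((k + 1 : ℕ) : ℝ) + μ = k + (μ + 1) := by push_cast; ring
  rw [h, Nat.factorial_succ]
  have h1 : ((k + 1 : ℕ) : ℝ) ≠ 0 := by positivity
  rw [Nat.cast_mul, mul_assoc, one_div, mul_inv, mul_comm _⁻¹, mul_assoc, inv_mul_cancel₀ h1,
    mul_one, one_div]

lemma besselCoeff_add_one {μ : ℝ} (hμ : 0 < μ) (k : ℕ) :
    (μ + k) * besselCoeff (μ + 1) k = besselCoeff μ k := by
  unfold besselCoeff
  have h : (k : ℝ) + μ ≠ 0 := by positivity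
  rw [← add_assoc, Real.Gamma_add_one h, add_comm μ]
  have := Real.Gamma_pos_of_pos (show 0 < (k : ℝ) + μ by positivity)
  field_simp

lemma summable_besselCoeff_mul_pow {μ : ℝ} (hμ : 0 < μ) (R : ℝ) :
    Summable fun k : ℕ => besselCoeff μ k * R ^ k := by
  refine Summable.of_norm_bounded_eventually_nat
    ((Real.summable_pow_div_factorial |R|)) ?_
  -- From `k = 2` on, `k + μ` lies where `Γ` is increasing and at least `Γ 2 = 1`, so the
  -- exponential series dominates.
  filter_upwards [eventually_ge_atTop 2] with k hk
  have hk' : (2 : ℝ) ≤ k := by exact_mod_cast hk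
  have h1 : 1 ≤ Real.Gamma (k + μ) := by
    rw [← Real.Gamma_two]
    exact Real.Gamma_strictMonoOn_Ici.monotoneOn (by simp) (by simp; linarith) (by linarith)
  rw [norm_mul, norm_pow, Real.norm_eq_abs, Real.norm_eq_abs,
    abs_of_pos (besselCoeff_pos hμ k), div_eq_inv_mul]
  gcongr
  unfold besselCoeff
  rw [one_div]
  gcongr
  exact le_mul_of_one_le_right (by positivity) h1

lemma summable_besselEntire {μ : ℝ} (hμ : 0 < μ) (x : ℝ) :
    Summable fun k : ℕ => (-1) ^ k * besselCoeff μ k * x ^ k := by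
  convert! summable_besselCoeff_mul_pow hμ (-x) using 2 with k
  rw [neg_pow]; ring

lemma hasDerivAt_besselEntire {μ : ℝ} (hμ : 0 < μ) (x : ℝ) :
    HasDerivAt (besselEntire μ) (-besselEntire (μ + 1) x) x := by
  set R : ℝ := |x| + 1 with hR
  have hx : x ∈ ball (0 : ℝ) R := by simp [hR]
  have hs : Summable fun k : ℕ => besselCoeff μ k * (k * R ^ (k - 1)) := by
    rw [← summable_nat_add_iff 1]
    convert! summable_besselCoeff_mul_pow (show 0 < μ + 1 by linarith) R using 2 with k
    rw [← besselCoeff_succ]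
    simp [mul_assoc]
  have key := hasDerivAt_tsum_of_isPreconnected (𝕜 := ℝ) (F := ℝ)
    (g := fun k x => (-1) ^ k * besselCoeff μ k * x ^ k)
    (g' := fun k x => (-1) ^ k * besselCoeff μ k * (k * x ^ (k - 1))) (t := ball (0 : ℝ) R)
    (y₀ := x) (y := x) hs isOpen_ball (convex_ball _ _).isPreconnected
    (fun k y _ => (hasDerivAt_pow k y).const_mul _) ?_ hx (summable_besselEntire hμ x) hx
  · convert! key using 1
    have hs' : Summable fun k : ℕ => (-1) ^ k * besselCoeff μ k * (k * x ^ (k - 1)) := by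
      refine Summable.of_norm_bounded hs fun k => ?_
      rw [norm_mul, norm_mul, norm_mul, norm_pow, norm_pow, norm_neg, norm_one, one_pow, one_mul,
        Real.norm_of_nonneg (besselCoeff_pos hμ k).le, Real.norm_of_nonneg (Nat.cast_nonneg k),
        Real.norm_eq_abs]
      have := (besselCoeff_pos hμ k).le
      gcongr
      linarith
    rw [hs'.tsum_eq_zero_add, besselEntire, ← tsum_neg]
    simp only [Nat.cast_zero, zero_mul, mul_zero, zero_add]
    refine tsum_congr fun k => ?_
    rw [← besselCoeff_succ, pow_succ, Nat.add_sub_cancel]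
    ring
  · intro k y hy
    rw [norm_mul, norm_mul, norm_mul, norm_pow, norm_pow, norm_neg, norm_one, one_pow, one_mul,
      Real.norm_of_nonneg (besselCoeff_pos hμ k).le, Real.norm_of_nonneg (Nat.cast_nonneg k)]
    have := (besselCoeff_pos hμ k).le
    have hy' : ‖y‖ ≤ R := by simpa using (mem_ball_zero_iff.1 hy).le
    gcongr

lemma continuous_besselEntire {μ : ℝ} (hμ : 0 < μ) : Continuous (besselEntire μ) :=
  continuous_iff_continuousAt.2 fun x => (hasDerivAt_besselEntire hμ x).continuousAt

lemma besselEntire_zero (μ : ℝ) : besselEntire μ 0 = 1 / Real.Gamma μ := by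
  rw [besselEntire, tsum_eq_single 0]
  · simp [besselCoeff]
  · intro k hk
    simp [hk]

/-- Termwise this is `(μ + k) Γ(k + μ) = Γ(k + μ + 1)`: the summand with factor `k` shifts its index
and becomes the `μ + 2` series. It is the three-term Bessel recurrence. -/
lemma besselEntire_recurrence {μ : ℝ} (hμ : 0 < μ) (x : ℝ) :
    μ * besselEntire (μ + 1) x - x * besselEntire (μ + 2) x = besselEntire μ x := by
  have h1 := summable_besselEntire (show 0 < μ + 1 by linarith) x
  have h2 := summable_besselEntire (show 0 < μ + 2 by linarith) x
  have h3 : Summable fun k : ℕ => (-1) ^ k * (k * besselCoeff (μ + 1) k) * x ^ k := by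
    rw [← summable_nat_add_iff 1]
    refine (h2.mul_left (-x)).congr fun k => ?_
    rw [show μ + 2 = (μ + 1) + 1 by ring, ← besselCoeff_succ (μ + 1)]
    ring
  have h4 : ∑' k : ℕ, (-1) ^ k * (k * besselCoeff (μ + 1) k) * x ^ k =
      -x * besselEntire (μ + 2) x := by
    rw [h3.tsum_eq_zero_add, besselEntire, ← tsum_mul_left]
    simp only [Nat.cast_zero, zero_mul, mul_zero, zero_add]
    refine tsum_congr fun k => ?_
    rw [show μ + 2 = (μ + 1) + 1 by ring, ← besselCoeff_succ (μ + 1)]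
    ring
  rw [sub_eq_add_neg, ← neg_mul, ← h4]
  simp only [besselEntire]
  rw [← tsum_mul_left, ← (h1.mul_left μ).tsum_add h3]
  refine tsum_congr fun k => ?_
  rw [← besselCoeff_add_one hμ]
  ring

lemma besselJ_eq (ν : ℝ) {t : ℝ} (ht : 0 < t) :
    besselJ ν t = (t / 2) ^ ν * besselEntire (ν + 1) (t ^ 2 / 4) := by
  rw [besselJ, besselEntire, ← tsum_mul_left]
  refine tsum_congr fun k => ?_
  rw [Real.rpow_add (by positivity), Real.rpow_mul (by positivity), Real.rpow_natCast, besselCoeff,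
    ← add_assoc]
  have : (t / 2) ^ (2 : ℝ) = t ^ 2 / 4 := by
    rw [Real.rpow_two]; ring
  rw [this]
  ring

/-- The everywhere smooth representative of `aSphere m`. -/
noncomputable def sphereCoeff (m : ℕ) (t : ℝ) : ℝ :=
  Real.Gamma ((m : ℝ) / 2) * besselEntire ((m : ℝ) / 2) (t ^ 2 / 4)

/-- The everywhere smooth representative of `aBall m`. -/
noncomputable def ballCoeff (m : ℕ) (t : ℝ) : ℝ :=
  Real.Gamma ((m : ℝ) / 2 + 1) * besselEntire ((m : ℝ) / 2 + 1) (t ^ 2 / 4)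

lemma aSphere_eq (m : ℕ) {t : ℝ} (ht : 0 < t) : aSphere m t = sphereCoeff m t := by
  rw [aSphere, besselJ_eq _ ht, sphereCoeff, show ((m : ℝ) - 2) / 2 + 1 = m / 2 by ring]
  have : 0 < (t / 2) ^ (((m : ℝ) - 2) / 2) := by positivity
  field_simp

lemma aBall_eq (m : ℕ) {t : ℝ} (ht : 0 < t) : aBall m t = ballCoeff m t := by
  rw [aBall, besselJ_eq _ ht, ballCoeff]
  have : 0 < (t / 2) ^ ((m : ℝ) / 2) := by positivity
  field_simp

variable {m : ℕ}

lemma sphereCoeff_zero (hm : 0 < m) : sphereCoeff m 0 = 1 := by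
  have := Real.Gamma_pos_of_pos (show 0 < (m : ℝ) / 2 by positivity)
  simp [sphereCoeff, besselEntire_zero, this.ne']

lemma continuous_sphereCoeff (hm : 0 < m) : Continuous (sphereCoeff m) := by
  have := continuous_besselEntire (show 0 < (m : ℝ) / 2 by positivity)
  unfold sphereCoeff
  fun_prop

lemma hasDerivAt_sphereCoeff (hm : 0 < m) (t : ℝ) :
    HasDerivAt (sphereCoeff m) (-(t / m) * ballCoeff m t) t := by
  have hμ : 0 < (m : ℝ) / 2 := by positivity
  have h1 : HasDerivAt (fun t : ℝ => t ^ 2 / 4) (t / 2) t := by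
    convert! (hasDerivAt_pow 2 t).div_const 4 using 1
    norm_num; ring
  have h2 := (HasDerivAt.comp t (hasDerivAt_besselEntire hμ (t ^ 2 / 4)) h1).const_mul
    (Real.Gamma ((m : ℝ) / 2))
  convert! h2 using 1
  rw [ballCoeff, Real.Gamma_add_one hμ.ne']
  field_simp

/-- The link between the two coefficients: it makes the numerator of the quadrature factor an
integral of `a°`. -/
lemma hasDerivAt_pow_mul_ballCoeff (hm : 0 < m) (t : ℝ) :
    HasDerivAt (fun t => t ^ m * ballCoeff m t) (m * (t ^ (m - 1) * sphereCoeff m t)) t := by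
  have hμ : 0 < (m : ℝ) / 2 := by positivity
  have h1 : HasDerivAt (fun t : ℝ => t ^ 2 / 4) (t / 2) t := by
    convert! (hasDerivAt_pow 2 t).div_const 4 using 1
    norm_num; ring
  have h2 := (HasDerivAt.comp t (hasDerivAt_besselEntire
    (show 0 < (m : ℝ) / 2 + 1 by positivity) (t ^ 2 / 4)) h1).const_mul
    (Real.Gamma ((m : ℝ) / 2 + 1))
  have h3 := (hasDerivAt_pow m t).mul h2
  convert! h3 using 1
  rw [sphereCoeff, ← besselEntire_recurrence hμ, Real.Gamma_add_one hμ.ne',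
    show (m : ℝ) / 2 + 1 + 1 = m / 2 + 2 by ring]
  obtain ⟨n, rfl⟩ : ∃ n, m = n + 1 := ⟨m - 1, by omega⟩
  simp only [Nat.add_sub_cancel, pow_succ, Function.comp]
  ring

end BesselSeries

/-! ### Existence of a first zero and positivity before it. -/

section FirstZero

variable {m : ℕ}

/-- Needed because `sInf ∅ = 0` would make `besselFirstZero` useless. Without a zero the logarithmic
derivative would solve a Riccati equation on all of `(0, ∞)`, whose solutions blow up in finite
time. -/
lemma exists_sphereCoeff_eq_zero (hm : 0 < m) : ∃ t : ℝ, 0 < t ∧ sphereCoeff m t = 0 := by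
  by_contra! hne
  have hcont := continuous_sphereCoeff hm
  have hpos : ∀ t : ℝ, 0 < t → 0 < sphereCoeff m t := by
    intro t ht
    by_contra! hle
    obtain ⟨s, hs, hs0⟩ := intermediate_value_Icc' ht.le hcont.continuousOn
      (show (0 : ℝ) ∈ Icc (sphereCoeff m t) (sphereCoeff m 0) from
        ⟨hle, by rw [sphereCoeff_zero hm]; exact zero_le_one⟩)
    rcases hs.1.eq_or_lt with h | h
    · rw [← h, sphereCoeff_zero hm] at hs0
      exact one_ne_zero hs0
    · exact hne s h hs0
  have hm' : (0 : ℝ) < m := by exact_mod_cast hm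
  -- For `t > 0` this is `-a°'/a°`, written so that both derivative formulas apply directly.
  set q : ℝ → ℝ := fun t => t ^ m * ballCoeff m t / (m * (t ^ (m - 1) * sphereCoeff m t)) with hq
  have hderiv : ∀ t : ℝ, 0 < t → HasDerivAt q (1 - (m - 1) / t * q t + q t ^ 2) t := by
    intro t ht
    have hA := hpos t ht
    have h1 := hasDerivAt_pow_mul_ballCoeff hm t
    have h2 := ((hasDerivAt_pow (m - 1) t).fun_mul (hasDerivAt_sphereCoeff hm t)).const_mul (m : ℝ)
    have h3 := h1.fun_div h2 (by positivity)
    convert! h3 using 1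
    simp only [hq]
    obtain ⟨n, rfl⟩ : ∃ n, m = n + 1 := ⟨m - 1, by omega⟩
    rcases n with _ | n
    · simp; field_simp
    · simp only [Nat.add_sub_cancel]
      push_cast
      field_simp
      ring
  have hatan : ∀ t : ℝ, 0 < t →
      HasDerivAt (fun t => Real.arctan (q t))
        (1 / (1 + q t ^ 2) * (1 - (m - 1) / t * q t + q t ^ 2)) t := fun t ht =>
    (hderiv t ht).arctan
  -- For `t ≥ m` the damping `(m - 1)/t` is at most `1`, so `arctan ∘ q` has slope at least `1/2`.
  -- Over length `2π` it would grow by `π`, more than the open range of `arctan` allows.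
  have hT : (m : ℝ) < m + 2 * Real.pi := by linarith [Real.pi_pos]
  obtain ⟨c, hc, hc'⟩ := exists_hasDerivAt_eq_slope (fun t => Real.arctan (q t)) _ hT
    (fun t ht => (hatan t (hm'.trans_le ht.1)).continuousAt.continuousWithinAt)
    (fun t ht => hatan t (hm'.trans ht.1))
  have hcm : 0 < c := hm'.trans hc.1
  have hκ : ((m : ℝ) - 1) / c ≤ 1 := by
    rw [div_le_one hcm]; linarith [hc.1]
  have hκ0 : 0 ≤ ((m : ℝ) - 1) / c := by
    have : (1 : ℝ) ≤ m := by exact_mod_cast hm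
    exact div_nonneg (by linarith) hcm.le
  have hlow : 1 / 2 ≤ 1 / (1 + q c ^ 2) * (1 - (m - 1) / c * q c + q c ^ 2) := by
    rw [one_div_mul_eq_div, div_le_div_iff₀ (by norm_num) (by positivity)]
    nlinarith [sq_nonneg (q c - 1), sq_nonneg (q c + 1),
      mul_nonneg hκ0 (sq_nonneg (q c - 1)), sq_nonneg (q c)]
  rw [hc', le_div_iff₀ (by linarith [Real.pi_pos])] at hlow
  have := Real.arctan_lt_pi_div_two (q (m + 2 * Real.pi))
  have := Real.neg_pi_div_two_lt_arctan (q m)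
  linarith

lemma besselJ_eq_zero_iff {t : ℝ} (hm : 0 < m) (ht : 0 < t) :
    besselJ (((m : ℝ) - 2) / 2) t = 0 ↔ sphereCoeff m t = 0 := by
  have h1 := Real.Gamma_pos_of_pos (show 0 < (m : ℝ) / 2 by positivity)
  rw [besselJ_eq _ ht, sphereCoeff, show ((m : ℝ) - 2) / 2 + 1 = m / 2 by ring,
    mul_eq_zero, mul_eq_zero, or_iff_right (by positivity), or_iff_right h1.ne']

lemma besselFirstZero_pos (hm : 0 < m) : 0 < besselFirstZero (((m : ℝ) - 2) / 2) := by
  obtain ⟨t, ht, ht0⟩ := exists_sphereCoeff_eq_zero hm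
  have h1 : ∀ᶠ s in 𝓝 (0 : ℝ), 0 < sphereCoeff m s :=
    (continuous_sphereCoeff hm).continuousAt.eventually_const_lt
      (by rw [sphereCoeff_zero hm]; exact zero_lt_one)
  obtain ⟨δ, hδ, hδ'⟩ := Metric.eventually_nhds_iff.1 h1
  refine hδ.trans_le (le_csInf ⟨t, ht, (besselJ_eq_zero_iff hm ht).2 ht0⟩ ?_)
  rintro s ⟨hs, hs0⟩
  rw [besselJ_eq_zero_iff hm hs] at hs0
  by_contra! hlt
  have := hδ' (show dist s 0 < δ by simpa [abs_of_pos hs] using hlt)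
  exact this.ne' hs0

lemma sphereCoeff_pos (hm : 0 < m) {t : ℝ} (ht : 0 ≤ t)
    (htj : t < besselFirstZero (((m : ℝ) - 2) / 2)) : 0 < sphereCoeff m t := by
  by_contra! hle
  obtain ⟨s, hs, hs0⟩ := intermediate_value_Icc' ht (continuous_sphereCoeff hm).continuousOn
    (show (0 : ℝ) ∈ Icc (sphereCoeff m t) (sphereCoeff m 0) from
      ⟨hle, by rw [sphereCoeff_zero hm]; exact zero_le_one⟩)
  rcases hs.1.eq_or_lt with h | h
  · rw [← h, sphereCoeff_zero hm] at hs0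
    exact one_ne_zero hs0
  · refine (htj.trans_le (csInf_le ⟨0, fun x hx => hx.1.le⟩
      ⟨h, (besselJ_eq_zero_iff hm h).2 hs0⟩)).not_ge hs.2

/-! ### Constancy from weighted means attained at endpoints. -/

/-- A continuous function each of whose weighted interval means is attained at an endpoint of the
interval is constant. -/
lemma eqOn_const_of_weighted_mean_endpoint {R : ℝ} {g w : ℝ → ℝ} (hg : ContinuousOn g (Ioc 0 R))
    (hw : ContinuousOn w (Ioc 0 R)) (hwpos : ∀ s ∈ Ioc 0 R, 0 < w s)
    (h : ∀ a b, 0 < a → a < b → b ≤ R →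
      ∫ s in a..b, w s * g s = g a * ∫ s in a..b, w s ∨
      ∫ s in a..b, w s * g s = g b * ∫ s in a..b, w s) :
    ∀ a ∈ Ioc 0 R, ∀ b ∈ Ioc 0 R, g a = g b := by
  -- The hypothesis is stable under `g ↦ -g`, so one inequality suffices.
  suffices H : ∀ g : ℝ → ℝ, ContinuousOn g (Ioc 0 R) →
      (∀ a b, 0 < a → a < b → b ≤ R →
      ∫ s in a..b, w s * g s = g a * ∫ s in a..b, w s ∨
      ∫ s in a..b, w s * g s = g b * ∫ s in a..b, w s) →
      ∀ a b, 0 < a → a < b → b ≤ R → g b ≤ g a by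
    have key : ∀ a b, 0 < a → a < b → b ≤ R → g a = g b := by
      intro a b ha hab hb
      refine le_antisymm ?_ (H g hg h a b ha hab hb)
      refine neg_le_neg_iff.1 (H (fun s => -g s) hg.neg ?_ a b ha hab hb)
      intro a b ha hab hb
      simpa only [mul_neg, intervalIntegral.integral_neg, neg_mul, neg_inj] using h a b ha hab hb
    intro a ha b hb
    rcases lt_trichotomy a b with hab | rfl | hab
    · exact key a b ha.1 hab hb.2
    · rfl
    · exact (key b a hb.1 hab ha.2).symm
  clear h hg g
  intro g hg h a b ha hab hb
  by_contra! hlt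
  have hsub : Icc a b ⊆ Ioc 0 R := fun s hs => ⟨ha.trans_le hs.1, hs.2.trans hb⟩
  -- `p` is the last point of `[a, b]` with value `g a`
  obtain ⟨p, ⟨hpI, hpv⟩, hpmax⟩ : ∃ p, IsGreatest {s | s ∈ Icc a b ∧ g s = g a} p := by
    have hcl : IsClosed {s | s ∈ Icc a b ∧ g s = g a} :=
      (hg.mono hsub).preimage_isClosed_of_isClosed isClosed_Icc (isClosed_singleton (x := g a))
    exact (isCompact_Icc.of_isClosed_subset hcl fun s hs => hs.1).exists_isGreatest
      ⟨a, ⟨le_rfl, hab.le⟩, rfl⟩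
  have hpb : p < b := lt_of_le_of_ne hpI.2 (by rintro rfl; exact hlt.ne hpv.symm)
  have hsub' : Icc p b ⊆ Ioc 0 R := (Icc_subset_Icc_left hpI.1).trans hsub
  -- `q` is the first point of `[p, b]` with value `g b`
  obtain ⟨q, ⟨hqI, hqv⟩, hqmin⟩ : ∃ q, IsLeast {s | s ∈ Icc p b ∧ g s = g b} q := by
    have hcl : IsClosed {s | s ∈ Icc p b ∧ g s = g b} :=
      (hg.mono hsub').preimage_isClosed_of_isClosed isClosed_Icc (isClosed_singleton (x := g b))
    exact (isCompact_Icc.of_isClosed_subset hcl fun s hs => hs.1).exists_isLeast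
      ⟨b, ⟨hpb.le, le_rfl⟩, rfl⟩
  have hpq : p < q := lt_of_le_of_ne hqI.1 (by rintro rfl; exact hlt.ne (hpv.symm.trans hqv))
  have hsub2 : Icc p q ⊆ Ioc 0 R := (Icc_subset_Icc_right hqI.2).trans hsub'
  -- A value at most `g p` inside would, by the intermediate value theorem, give a later point with
  -- value `g a`, against the choice of `p`; `hhi` is the mirror image for `q`.
  have hlo : ∀ s ∈ Ioo p q, g p < g s := by
    intro s hs
    by_contra! hle
    obtain ⟨z, hz, hzv⟩ := intermediate_value_Icc hs.2.le
      (hg.mono ((Icc_subset_Icc_left hs.1.le).trans hsub2))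
      (show g p ∈ Icc (g s) (g q) from ⟨hle, by rw [hpv, hqv]; exact hlt.le⟩)
    have := hpmax ⟨⟨hpI.1.trans (hs.1.le.trans hz.1), hz.2.trans hqI.2⟩, hzv.trans hpv⟩
    linarith [hs.1, hz.1]
  have hhi : ∀ s ∈ Ioo p q, g s < g q := by
    intro s hs
    by_contra! hle
    obtain ⟨z, hz, hzv⟩ := intermediate_value_Icc hs.1.le
      (hg.mono ((Icc_subset_Icc_right hs.2.le).trans hsub2))
      (show g q ∈ Icc (g p) (g s) from ⟨by rw [hpv, hqv]; exact hlt.le, hle⟩)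
    have := hqmin ⟨⟨hz.1, hz.2.trans (hs.2.le.trans hqI.2)⟩, hzv.trans hqv⟩
    linarith [hs.2, hz.2]
  have hgc := hg.mono hsub2
  have hwc := hw.mono hsub2
  have hmid : (p + q) / 2 ∈ Ioo p q := ⟨by linarith, by linarith⟩
  -- With `h2`, the weighted mean over `[p, q]` lies strictly between the endpoint values, so
  -- neither alternative in `h` can hold.
  have h1 : ∫ s in p..q, w s * g p < ∫ s in p..q, w s * g s := by
    refine intervalIntegral.integral_lt_integral_of_continuousOn_of_le_of_exists_lt hpq
      (hwc.mul continuousOn_const) (hwc.mul hgc) (fun s hs => ?_)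
      ⟨_, Ioo_subset_Icc_self hmid,
        mul_lt_mul_of_pos_left (hlo _ hmid) (hwpos _ (hsub2 (Ioo_subset_Icc_self hmid)))⟩
    have := hwpos s (hsub2 ⟨hs.1.le, hs.2⟩)
    refine mul_le_mul_of_nonneg_left ?_ this.le
    rcases hs.2.eq_or_lt with rfl | h'
    · rw [hpv, hqv]; exact hlt.le
    · exact (hlo s ⟨hs.1, h'⟩).le
  have h2 : ∫ s in p..q, w s * g s < ∫ s in p..q, w s * g q := by
    refine intervalIntegral.integral_lt_integral_of_continuousOn_of_le_of_exists_lt hpq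
      (hwc.mul hgc) (hwc.mul continuousOn_const) (fun s hs => ?_)
      ⟨_, Ioo_subset_Icc_self hmid,
        mul_lt_mul_of_pos_left (hhi _ hmid) (hwpos _ (hsub2 (Ioo_subset_Icc_self hmid)))⟩
    have := hwpos s (hsub2 ⟨hs.1.le, hs.2⟩)
    refine mul_le_mul_of_nonneg_left ?_ this.le
    rcases hs.2.eq_or_lt with rfl | h'
    · exact le_rfl
    · exact (hhi s ⟨hs.1, h'⟩).le
  rw [intervalIntegral.integral_mul_const, mul_comm] at h1
  rw [intervalIntegral.integral_mul_const, mul_comm (∫ s in p..q, w s)] at h2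
  rcases h p q (hsub2 ⟨le_rfl, hpq.le⟩).1 hpq (hsub2 ⟨hpq.le, le_rfl⟩).2 with h' | h'
  · exact h1.ne h'.symm
  · exact h2.ne h'

end FirstZero

/-! ### Polar coordinates and the annular identity as a one-dimensional mean. -/

section PolarCoordinates

section Polar

variable {E : Type*} [NormedAddCommGroup E] [NormedSpace ℝ E] [MeasurableSpace E] [BorelSpace E]
  [FiniteDimensional ℝ E] [Nontrivial E]

/-- Integration in polar coordinates. -/
lemma integral_eq_integral_Ioi_toSphere (μ : Measure E) [μ.IsAddHaarMeasure] {F : E → ℝ}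
    (hF : Integrable F μ) :
    ∫ x, F x ∂μ = ∫ s in Ioi (0 : ℝ), s ^ (Module.finrank ℝ E - 1) *
      ∫ y : sphere (0 : E) 1, F (s • (y : E)) ∂μ.toSphere := by
  set G : sphere (0 : E) 1 × Ioi (0 : ℝ) → ℝ := fun p => F ((p.2 : ℝ) • (p.1 : E)) with hG
  have hcomp : ∀ x : ({0}ᶜ : Set E), G (homeomorphUnitSphereProd E x) = F x := by
    intro x
    have hx : ‖(x : E)‖ ≠ 0 := norm_ne_zero_iff.2 x.2
    simp [hG, smul_smul, hx]
  have hmp := μ.measurePreserving_homeomorphUnitSphereProd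
  have hint : Integrable G (μ.toSphere.prod (.volumeIoiPow (Module.finrank ℝ E - 1))) := by
    rw [← hmp.integrable_comp_emb (Homeomorph.measurableEmbedding _)]
    have : G ∘ homeomorphUnitSphereProd E = F ∘ ((↑) : ({0}ᶜ : Set E) → E) := funext hcomp
    rw [this, ← integrableOn_iff_comap_subtypeVal (measurableSet_singleton _).compl]
    exact hF.integrableOn
  calc
    ∫ x, F x ∂μ = ∫ x : ({(0)}ᶜ : Set E), F x ∂(μ.comap (↑)) := by
      rw [integral_subtype_comap (measurableSet_singleton _).compl F,
        restrict_compl_singleton]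
    _ = ∫ p, G p ∂μ.toSphere.prod (.volumeIoiPow (Module.finrank ℝ E - 1)) := by
      rw [← hmp.integral_comp (Homeomorph.measurableEmbedding _)]
      simp only [hcomp]
    _ = ∫ s : Ioi (0 : ℝ), ∫ y, G (y, s) ∂μ.toSphere
          ∂.volumeIoiPow (Module.finrank ℝ E - 1) := integral_prod_symm _ hint
    _ = _ := by
      simp only [Measure.volumeIoiPow, ENNReal.ofReal]
      rw [integral_withDensity_eq_integral_smul,
        integral_subtype_comap measurableSet_Ioi fun a ↦
          Real.toNNReal (a ^ (Module.finrank ℝ E - 1)) • ∫ y : sphere (0 : E) 1, F (a • (y : E))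
            ∂μ.toSphere,
        setIntegral_congr_fun measurableSet_Ioi fun x hx ↦ ?_]
      · rw [NNReal.smul_def, Real.coe_toNNReal _ (pow_nonneg hx.out.le _), smul_eq_mul]
      · exact (measurable_subtype_coe.pow_const _).real_toNNReal

end Polar

variable {m : ℕ} {x : EuclideanSpace ℝ (Fin m)} {u : EuclideanSpace ℝ (Fin m) → ℝ} {R : ℝ}

local notation "sphereArea" m => Measure.real (Measure.toSphere (volume (α := EuclideanSpace ℝ (Fin m)))) univ

lemma sphereArea_eq (m : ℕ) : (sphereArea m) =
    m * volume.real (ball (0 : EuclideanSpace ℝ (Fin m)) 1) := by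
  rw [Measure.toSphere_real_apply_univ, finrank_euclideanSpace_fin]

lemma volume_real_unitBall_pos (m : ℕ) :
    0 < volume.real (ball (0 : EuclideanSpace ℝ (Fin m)) 1) :=
  ENNReal.toReal_pos (measure_ball_pos _ _ one_pos).ne' measure_ball_lt_top.ne

lemma sphereArea_pos (hm : 0 < m) : 0 < (sphereArea m) := by
  rw [sphereArea_eq]
  have := volume_real_unitBall_pos m
  positivity

lemma volume_real_ball (x : EuclideanSpace ℝ (Fin m)) {r : ℝ} (hr : 0 < r) :
    volume.real (ball x r) = r ^ m * volume.real (ball (0 : EuclideanSpace ℝ (Fin m)) 1) := by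
  rw [measureReal_def, Measure.addHaar_ball_of_pos _ _ hr, finrank_euclideanSpace_fin,
    ENNReal.toReal_mul, ENNReal.toReal_ofReal (by positivity), measureReal_def]

lemma sphericalMean_zero (hm : 0 < m) (x : EuclideanSpace ℝ (Fin m))
    (u : EuclideanSpace ℝ (Fin m) → ℝ) : sphericalMean x 0 u = u x := by
  have := (sphereArea_pos hm).ne'
  simp only [sphericalMean, zero_smul, add_zero, integral_const, smul_eq_mul]
  field_simp

lemma continuousOn_sphericalMean (hu : ContinuousOn u (closedBall x R)) :
    ContinuousOn (fun r => sphericalMean x r u) (Icc 0 R) := by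
  have hmaps : ∀ r ∈ Icc 0 R, ∀ y : sphere (0 : EuclideanSpace ℝ (Fin m)) 1,
      x + r • (y : EuclideanSpace ℝ (Fin m)) ∈ closedBall x R := by
    intro r hr y
    rw [mem_closedBall, dist_self_add_left, norm_smul, Real.norm_of_nonneg hr.1,
      norm_eq_of_mem_sphere, mul_one]
    exact hr.2
  obtain ⟨C, hC⟩ := (isCompact_closedBall x R).exists_bound_of_continuousOn hu
  refine continuousOn_const.mul (continuousOn_of_dominated (bound := fun _ => C) ?_ ?_
    (integrable_const _) ?_)
  · intro r hr
    exact (hu.comp_continuous (by fun_prop) (hmaps r hr)).aestronglyMeasurable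
  · exact fun r hr => .of_forall fun y => hC _ (hmaps r hr y)
  · exact .of_forall fun y => hu.comp (by fun_prop) fun r hr => hmaps r hr y

lemma isOpen_annulus (x : EuclideanSpace ℝ (Fin m)) (a b : ℝ) : IsOpen (annulus x a b) := by
  have h : Continuous fun y => dist x y := by fun_prop
  exact (isOpen_lt continuous_const h).inter (isOpen_lt h continuous_const)

lemma annulus_subset_closedBall (x : EuclideanSpace ℝ (Fin m)) (a b : ℝ) :
    annulus x a b ⊆ closedBall x b := fun y hy => by
  rw [mem_closedBall, dist_comm]; exact hy.2.le

lemma volume_real_annulus_pos (hm : 0 < m) (x : EuclideanSpace ℝ (Fin m)) {a b : ℝ} (ha : 0 ≤ a)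
    (hab : a < b) : 0 < volume.real (annulus x a b) := by
  have : Nonempty (Fin m) := ⟨⟨0, hm⟩⟩
  obtain ⟨v, hv⟩ := exists_norm_eq (EuclideanSpace ℝ (Fin m)) (show 0 ≤ (a + b) / 2 by linarith)
  refine ENNReal.toReal_pos ((isOpen_annulus x a b).measure_pos _ ⟨x + v, ?_⟩).ne'
    ((measure_mono (annulus_subset_closedBall x a b)).trans_lt measure_closedBall_lt_top).ne
  simp only [annulus, mem_ofPred_eq, dist_self_add_right, hv]
  constructor
  · linarith
  · linarith

/-- Radially weighted integrals over an annulus in terms of spherical means. -/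
lemma setIntegral_annulus_eq (hm : 0 < m) {k : ℝ → ℝ} (hk : Continuous k) {a b : ℝ} (ha : 0 ≤ a)
    (hab : a ≤ b) (hu : ContinuousOn u (closedBall x b)) :
    ∫ y in annulus x a b, k (dist x y) * u y =
      (sphereArea m) * ∫ s in a..b, s ^ (m - 1) * k s * sphericalMean x s u := by
  have : Nonempty (Fin m) := ⟨⟨0, hm⟩⟩
  have hA := (isOpen_annulus x a b).measurableSet
  have hint : IntegrableOn (fun y => k (dist x y) * u y) (annulus x a b) := by
    refine IntegrableOn.mono_set ?_ (annulus_subset_closedBall x a b)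
    exact ContinuousOn.integrableOn_compact (isCompact_closedBall x b)
      ((hk.comp (by fun_prop)).continuousOn.mul hu)
  rw [← integral_indicator hA, ← integral_add_left_eq_self _ x,
    integral_eq_integral_Ioi_toSphere volume
      (((integrable_indicator_iff hA).2 hint).comp_add_left x), finrank_euclideanSpace_fin,
    intervalIntegral.integral_of_le hab, integral_Ioc_eq_integral_Ioo,
    ← integral_const_mul]
  have hmem : ∀ s : ℝ, 0 < s → ∀ y : sphere (0 : EuclideanSpace ℝ (Fin m)) 1,
      dist x (x + s • (y : EuclideanSpace ℝ (Fin m))) = s := by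
    intro s hs y
    rw [dist_self_add_right, norm_smul, Real.norm_of_nonneg hs.le, norm_eq_of_mem_sphere, mul_one]
  rw [setIntegral_eq_of_subset_of_forall_sdiff_eq_zero (t := Ioi (0 : ℝ)) (s := Ioo a b)
    measurableSet_Ioi (fun s hs => ha.trans_lt hs.1)]
  · refine setIntegral_congr_fun measurableSet_Ioo fun s hs => ?_
    have hs0 : 0 < s := ha.trans_lt hs.1
    have h1 : ∀ y : sphere (0 : EuclideanSpace ℝ (Fin m)) 1,
        (annulus x a b).indicator (fun y => k (dist x y) * u y)
          (x + s • (y : EuclideanSpace ℝ (Fin m))) =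
        k s * u (x + s • (y : EuclideanSpace ℝ (Fin m))) := by
      intro y
      rw [indicator_of_mem, hmem s hs0]
      simpa only [annulus, mem_ofPred_eq, hmem s hs0, mem_Ioo] using hs
    have h2 := (sphereArea_pos hm).ne'
    simp only [h1, integral_const_mul, sphericalMean]
    field_simp
  · intro s hs
    have hs0 : 0 < s := hs.1
    have h1 : ∀ y : sphere (0 : EuclideanSpace ℝ (Fin m)) 1,
        (annulus x a b).indicator (fun y => k (dist x y) * u y)
          (x + s • (y : EuclideanSpace ℝ (Fin m))) = 0 := by
      intro y
      rw [indicator_of_notMem]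
      simpa only [annulus, mem_ofPred_eq, hmem s hs0, mem_Ioo] using hs.2
    simp only [h1, integral_zero, mul_zero]

lemma intervalIntegral_sphereCoeff (hm : 0 < m) {lam : ℝ} (hlam : 0 < lam) (a b : ℝ) :
    m * ∫ s in a..b, s ^ (m - 1) * sphereCoeff m (lam * s) =
      b ^ m * ballCoeff m (lam * b) - a ^ m * ballCoeff m (lam * a) := by
  have hc := continuous_sphereCoeff hm
  rw [← intervalIntegral.integral_const_mul]
  refine intervalIntegral.integral_eq_sub_of_hasDerivAt (f := fun s => s ^ m * ballCoeff m (lam * s))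
    (fun s _ => ?_) (Continuous.intervalIntegrable (by fun_prop) _ _)
  -- The factor `lam^(-m)` undoes the rescaling `t = lam * s` in `t^m`.
  have h1 := ((hasDerivAt_pow_mul_ballCoeff hm (lam * s)).comp s
    ((hasDerivAt_id s).const_mul lam)).const_mul (lam ^ m)⁻¹
  convert! h1 using 1
  · ext s
    simp only [Function.comp, mul_pow]
    field_simp
  · obtain ⟨n, rfl⟩ : ∃ n, m = n + 1 := ⟨m - 1, by omega⟩
    simp only [Nat.add_sub_cancel, mul_pow, pow_succ]
    field_simp

/-- The annulus volume and the sphere area cancel, leaving a statement about the weighted mean of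
`sphericalMean / sphereCoeff`. -/
lemma AnnularIdentity.integral_eq (hm : 0 < m) {lam : ℝ} (hlam : 0 < lam) {r₁ r₂ r : ℝ}
    (h₁ : 0 < r₁) (h₁₂ : r₁ < r₂) (hr : 0 < r) (hu : ContinuousOn u (closedBall x r₂))
    (h : AnnularIdentity lam u x r₁ r₂ r) :
    ∫ s in r₁..r₂, s ^ (m - 1) * sphericalMean x s u =
      sphericalMean x r u / sphereCoeff m (lam * r) *
        ∫ s in r₁..r₂, s ^ (m - 1) * sphereCoeff m (lam * s) := by
  have hA := volume_real_annulus_pos hm x h₁.le h₁₂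
  have hV := volume_real_unitBall_pos m
  have hpolar := setIntegral_annulus_eq hm (k := fun _ => 1) continuous_const h₁.le h₁₂.le hu
  have hcoef := intervalIntegral_sphereCoeff hm hlam r₁ r₂
  simp only [one_mul, mul_one] at hpolar
  have h₂ : 0 < r₂ := h₁.trans h₁₂
  rw [AnnularIdentity, volumeMean, hpolar, aBall_eq m (by positivity), aBall_eq m (by positivity),
    aSphere_eq m (by positivity), volume_real_ball x h₁, volume_real_ball x h₂, sphereArea_eq] at h
  have hm' : (m : ℝ) ≠ 0 := by positivity
  set V := volume.real (ball (0 : EuclideanSpace ℝ (Fin m)) 1)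
  set W := volume.real (annulus x r₁ r₂)
  have h3 : ballCoeff m (lam * r₂) * (r₂ ^ m * V) - ballCoeff m (lam * r₁) * (r₁ ^ m * V) =
      m * V * ∫ s in r₁..r₂, s ^ (m - 1) * sphereCoeff m (lam * s) := by
    linear_combination (-V) * hcoef
  rw [h3] at h
  have h4 : W⁻¹ * (m * V) ≠ 0 := by positivity
  refine mul_left_cancel₀ h4 ?_
  rw [mul_assoc W⁻¹, h]
  rw [div_mul_eq_div_div, div_eq_inv_mul _ W]
  ring

end PolarCoordinates

/-! ### Taylor expansion and second moments of balls. -/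

section BallMoments

/-- Second order Taylor expansion with uniform little-o remainder. -/
lemma exists_taylor_two_bound {E : Type*} [NormedAddCommGroup E] [NormedSpace ℝ E] {f : E → ℝ}
    {x : E} (hf : ContDiffAt ℝ 2 f x) {ε : ℝ} (hε : 0 < ε) :
    ∃ δ > 0, ∀ z : E, ‖z‖ < δ →
      |f (x + z) - f x - fderiv ℝ f x z - 1 / 2 * fderiv ℝ (fderiv ℝ f) x z z| ≤ ε * ‖z‖ ^ 2 := by
  have hsymm : IsSymmSndFDerivAt ℝ f x := hf.isSymmSndFDerivAt (by simp)
  have hd1 : ∀ᶠ y in 𝓝 x, DifferentiableAt ℝ f y := by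
    filter_upwards [hf.eventually (by simp)] with y hy
    exact hy.differentiableAt (by simp)
  have hd2 : DifferentiableAt ℝ (fderiv ℝ f) x :=
    (hf.fderiv_right (m := 1) (by norm_num)).differentiableAt (by simp)
  have hlo := (hasFDerivAt_iff_isLittleO_nhds_zero.1 hd2.hasFDerivAt).def hε
  have hd1' : ∀ᶠ z in 𝓝 (0 : E), DifferentiableAt ℝ f (x + z) := by
    have : Tendsto (fun z : E => x + z) (𝓝 0) (𝓝 x) := by
      simpa using (continuous_const_add x).tendsto 0
    exact this.eventually hd1
  obtain ⟨δ, hδ, hδ'⟩ := Metric.eventually_nhds_iff.1 (hlo.and hd1')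
  refine ⟨δ, hδ, fun z hz => ?_⟩
  set H := fderiv ℝ (fderiv ℝ f) x with hH
  set g : E → ℝ := fun z => f (x + z) - f x - fderiv ℝ f x z - 1 / 2 * H z z with hg
  -- Symmetry of the second derivative makes the derivative of `1/2 * H z z` equal to `H w`; the
  -- remainder of `fderiv ℝ f` then bounds `g` through the mean value inequality.
  have hgd : ∀ w ∈ closedBall (0 : E) ‖z‖,
      HasFDerivWithinAt g (fderiv ℝ f (x + w) - fderiv ℝ f x - H w) (closedBall (0 : E) ‖z‖) w := by
    intro w hw
    have hw' : dist w 0 < δ := (mem_closedBall.1 hw).trans_lt hz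
    have h1 : HasFDerivAt (fun z => f (x + z)) (fderiv ℝ f (x + w)) w := by
      exact ((hδ' hw').2.hasFDerivAt).comp w ((hasFDerivAt_id w).const_add x)
    have h2 : HasFDerivAt (fun z => H z z) (H w + H.flip w) w := by
      have h3 := H.hasFDerivAt (x := w) |>.clm_apply (hasFDerivAt_id w)
      convert! h3 using 1
    have h4 := (((h1.sub_const (f x)).sub (fderiv ℝ f x).hasFDerivAt).sub
      (h2.const_mul (1 / 2))).hasFDerivWithinAt (s := closedBall (0 : E) ‖z‖)
    convert! h4 using 1
    have h5 : H.flip w = H w := by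
      ext v
      rw [ContinuousLinearMap.flip_apply]
      exact hsymm v w
    rw [h5, ← two_smul ℝ (H w), smul_smul]
    norm_num
  have hbound : ∀ w ∈ closedBall (0 : E) ‖z‖,
      ‖fderiv ℝ f (x + w) - fderiv ℝ f x - H w‖ ≤ ε * ‖z‖ := by
    intro w hw
    have hw' : dist w 0 < δ := (mem_closedBall.1 hw).trans_lt hz
    refine (hδ' hw').1.trans ?_
    have := mem_closedBall_zero_iff.1 hw
    gcongr
  have := (convex_closedBall (0 : E) ‖z‖).norm_image_sub_le_of_norm_hasFDerivWithin_le hgd hbound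
    (mem_closedBall_self (norm_nonneg z)) (mem_closedBall_zero_iff.2 le_rfl : z ∈ _)
  have hg0 : g 0 = 0 := by simp [hg]
  rw [hg0, sub_zero, sub_zero, Real.norm_eq_abs] at this
  calc _ ≤ ε * ‖z‖ * ‖z‖ := this
    _ = _ := by ring

variable {m : ℕ}

local notation "E" => EuclideanSpace ℝ (Fin m)

/-- Gives all the moments by symmetry: `-id` kills linear terms, reflecting one coordinate kills
mixed products, and swapping two coordinates equates the squares. -/
lemma setIntegral_ball_comp_isometry (T : E ≃ₗᵢ[ℝ] E) (f : E → ℝ) (r : ℝ) :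
    ∫ z in ball (0 : E) r, f (T z) = ∫ z in ball (0 : E) r, f z := by
  have h := T.measurePreserving.setIntegral_preimage_emb T.toHomeomorph.measurableEmbedding f
    (ball 0 r)
  rw [← h]
  congr 2
  ext z
  simp

lemma integrableOn_ball_of_continuous {f : E → ℝ} (hf : Continuous f) (r : ℝ) :
    IntegrableOn f (ball (0 : E) r) :=
  (hf.continuousOn.integrableOn_compact (isCompact_closedBall 0 r)).mono_set ball_subset_closedBall

lemma setIntegral_ball_linear (L : E →L[ℝ] ℝ) (r : ℝ) : ∫ z in ball (0 : E) r, L z = 0 := by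
  have h := setIntegral_ball_comp_isometry (LinearIsometryEquiv.neg ℝ) (fun z => L z) r
  simp only [LinearIsometryEquiv.coe_neg, map_neg, integral_neg] at h
  linarith

lemma setIntegral_ball_coord_mul_coord {i j : Fin m} (hij : i ≠ j) (r : ℝ) :
    ∫ z in ball (0 : E) r, z i * z j = 0 := by
  have h := setIntegral_ball_comp_isometry (LinearIsometryEquiv.piLpCongrRight 2
    (fun k : Fin m => if k = i then LinearIsometryEquiv.neg ℝ else LinearIsometryEquiv.refl ℝ ℝ))
    (fun z => z i * z j) r
  simp [hij.symm, integral_neg] at h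
  linarith

lemma setIntegral_ball_coord_sq_eq (i j : Fin m) (r : ℝ) :
    ∫ z in ball (0 : E) r, z i * z i = ∫ z in ball (0 : E) r, z j * z j := by
  have h := setIntegral_ball_comp_isometry
    (LinearIsometryEquiv.piLpCongrLeft 2 ℝ ℝ (Equiv.swap i j)) (fun z => z j * z j) r
  simpa [LinearIsometryEquiv.piLpCongrLeft_apply, Equiv.piCongrLeft'] using h

/-- Lets the polar formula for annuli serve balls, the centre being a null set. -/
lemma annulus_zero (x : E) (r : ℝ) : annulus x 0 r = ball x r \ {x} := by
  ext y
  simp [annulus, dist_comm y x, and_comm, eq_comm]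

lemma setIntegral_annulus_zero (hm : 0 < m) (x : E) (r : ℝ) (f : E → ℝ) :
    ∫ y in annulus x 0 r, f y = ∫ y in ball x r, f y := by
  have : Nonempty (Fin m) := ⟨⟨0, hm⟩⟩
  rw [annulus_zero]
  exact setIntegral_congr_set (sdiff_null_ae_eq_self (measure_singleton x))

lemma sphericalMean_one (hm : 0 < m) (x : E) (r : ℝ) : sphericalMean x r (fun _ => 1) = 1 := by
  have h := sphericalMean_zero hm x (fun _ => 1)
  simpa [sphericalMean] using h

lemma setIntegral_ball_norm_sq (hm : 0 < m) {r : ℝ} (hr : 0 ≤ r) :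
    ∫ z in ball (0 : E) r, ‖z‖ ^ 2 =
      m * volume.real (ball (0 : E) 1) * (r ^ (m + 2) / (m + 2)) := by
  have h := setIntegral_annulus_eq (x := (0 : E)) (u := fun _ => 1) hm
    (k := fun s => s ^ 2) (by fun_prop) le_rfl hr continuousOn_const
  rw [setIntegral_annulus_zero hm, sphereArea_eq] at h
  simp only [dist_zero_left, mul_one, sphericalMean_one hm] at h
  rw [h]
  congr 1
  have : ∀ s : ℝ, s ^ (m - 1) * s ^ 2 = s ^ (m + 1) := fun s => by
    rw [← pow_add]; congr 1; omega
  simp only [this, integral_pow]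
  push_cast
  ring

lemma setIntegral_ball_coord_sq (hm : 0 < m) (i : Fin m) {r : ℝ} (hr : 0 ≤ r) :
    ∫ z in ball (0 : E) r, z i * z i = volume.real (ball (0 : E) 1) * (r ^ (m + 2) / (m + 2)) := by
  have h := setIntegral_ball_norm_sq hm hr
  simp only [EuclideanSpace.real_norm_sq_eq] at h
  simp only [sq] at h
  rw [integral_finsetSum _ fun j _ => integrableOn_ball_of_continuous (by fun_prop) r,
    Finset.sum_congr rfl fun j _ => setIntegral_ball_coord_sq_eq j i r, Finset.sum_const,
    Finset.card_univ, Fintype.card_fin, nsmul_eq_mul, mul_assoc] at h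
  exact mul_left_cancel₀ (by positivity) h

/-- Only the diagonal survives, so the trace appears; for the Hessian it is the Laplacian. -/
lemma setIntegral_ball_bilinear (hm : 0 < m) (H : E →L[ℝ] E →L[ℝ] ℝ) {r : ℝ} (hr : 0 ≤ r) :
    ∫ z in ball (0 : E) r, H z z =
      (∑ i, H (EuclideanSpace.basisFun (Fin m) ℝ i) (EuclideanSpace.basisFun (Fin m) ℝ i)) *
        (volume.real (ball (0 : E) 1) * (r ^ (m + 2) / (m + 2))) := by
  set e := EuclideanSpace.basisFun (Fin m) ℝ with he
  have hexp : ∀ z : E, H z z = ∑ i, ∑ j, z i * z j * H (e i) (e j) := by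
    intro z
    have hz : z = ∑ i, z i • e i := by
      simpa [he] using (e.sum_repr z).symm
    conv_lhs => rw [hz]
    simp only [map_sum, sum_apply, map_smul, smul_apply,
      smul_eq_mul, Finset.mul_sum]
    rw [Finset.sum_comm]
    refine Finset.sum_congr rfl fun i _ => Finset.sum_congr rfl fun j _ => by ring
  rw [setIntegral_congr_fun measurableSet_ball fun z _ => hexp z,
    integral_finsetSum _ fun i _ => integrableOn_ball_of_continuous (by fun_prop) r,
    Finset.sum_mul]
  refine Finset.sum_congr rfl fun i _ => ?_
  rw [integral_finsetSum _ fun j _ => integrableOn_ball_of_continuous (by fun_prop) r,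
    Finset.sum_eq_single i]
  · rw [integral_mul_const, setIntegral_ball_coord_sq hm i hr, mul_comm]
  · intro j _ hji
    rw [integral_mul_const, setIntegral_ball_coord_mul_coord hji.symm, zero_mul]
  · simp

lemma laplacian_eq_sum_fderiv (u : E → ℝ) (x : E) :
    Laplacian.laplacian u x = ∑ i, fderiv ℝ (fderiv ℝ u) x (EuclideanSpace.basisFun (Fin m) ℝ i)
      (EuclideanSpace.basisFun (Fin m) ℝ i) := by
  rw [InnerProductSpace.laplacian_eq_iteratedFDeriv_orthonormalBasis u
    (EuclideanSpace.basisFun (Fin m) ℝ)]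
  simp [iteratedFDeriv_two_apply]

end BallMoments

/-! ### Mean value formula, smoothness and the differential equation. -/

section MeanValue

variable {m : ℕ} {D : Set (EuclideanSpace ℝ (Fin m))} {u : EuclideanSpace ℝ (Fin m) → ℝ}
  {lam ρ : ℝ}

/-- The mean value formula for spheres follows from the annular identities with a fixed centre. -/
lemma sphericalMean_eq_of_annularIdentity (hm : 0 < m) (hlam : 0 < lam)
    {x : EuclideanSpace ℝ (Fin m)} {R : ℝ}
    (hR : R < besselFirstZero (((m : ℝ) - 2) / 2) / lam) (hu : ContinuousOn u (closedBall x R))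
    (h : ∀ r₁ r₂ : ℝ, 0 < r₁ → r₁ < r₂ → r₂ ≤ R →
      (∀ r ∈ Ioo r₁ r₂, AnnularIdentity lam u x r₁ r₂ r) ∨
        AnnularIdentity lam u x r₁ r₂ r₁ ∨ AnnularIdentity lam u x r₁ r₂ r₂) :
    ∀ r ∈ Icc 0 R, sphericalMean x r u = u x * sphereCoeff m (lam * r) := by
  have hφ := continuousOn_sphericalMean hu
  have hA : Continuous fun s => sphereCoeff m (lam * s) :=
    (continuous_sphereCoeff hm).comp (by fun_prop)
  have hApos : ∀ s ∈ Icc 0 R, 0 < sphereCoeff m (lam * s) := fun s hs =>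
    sphereCoeff_pos hm (mul_nonneg hlam.le hs.1)
      (by rw [mul_comm]; exact (lt_div_iff₀ hlam).1 (hs.2.trans_lt hR))
  set g : ℝ → ℝ := fun s => sphericalMean x s u / sphereCoeff m (lam * s) with hg
  have hgc : ContinuousOn g (Icc 0 R) := hφ.div hA.continuousOn fun s hs => (hApos s hs).ne'
  have hconst : ∀ a ∈ Ioc 0 R, ∀ b ∈ Ioc 0 R, g a = g b := by
    refine eqOn_const_of_weighted_mean_endpoint
      (w := fun s => s ^ (m - 1) * sphereCoeff m (lam * s)) (hgc.mono Ioc_subset_Icc_self)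
      (by fun_prop) (fun s hs => mul_pos (pow_pos hs.1 _) (hApos s ⟨hs.1.le, hs.2⟩)) ?_
    intro a b ha hab hb
    have hub := hu.mono (closedBall_subset_closedBall hb)
    have hcongr : ∫ s in a..b, s ^ (m - 1) * sphereCoeff m (lam * s) * g s =
        ∫ s in a..b, s ^ (m - 1) * sphericalMean x s u := by
      refine intervalIntegral.integral_congr fun s hs => ?_
      rw [uIcc_of_le hab.le] at hs
      have := hApos s ⟨ha.le.trans hs.1, hs.2.trans hb⟩
      simp only [hg]
      field_simp
    simp only [hcongr]
    have key : ∀ r, 0 < r → AnnularIdentity lam u x a b r →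
        ∫ s in a..b, s ^ (m - 1) * sphericalMean x s u =
          g r * ∫ s in a..b, s ^ (m - 1) * sphereCoeff m (lam * s) := fun r hr hid =>
      hid.integral_eq hm hlam ha hab hr hub
    -- If every interior `r` works, letting `r` decrease to `a` yields the left endpoint case.
    rcases h a b ha hab hb with hall | h1 | h2
    · left
      have hev : ∀ᶠ r in 𝓝[>] a, ∫ s in a..b, s ^ (m - 1) * sphericalMean x s u =
          g r * ∫ s in a..b, s ^ (m - 1) * sphereCoeff m (lam * s) := by
        filter_upwards [Ioo_mem_nhdsGT hab] with r hr
        exact key r (ha.trans hr.1) (hall r hr)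
      have hlim : Tendsto g (𝓝[>] a) (𝓝 (g a)) := by
        refine ((hgc a ⟨ha.le, hab.le.trans hb⟩).mono_left ?_)
        rw [← nhdsWithin_Ioo_eq_nhdsGT hab]
        exact nhdsWithin_mono _ fun s hs => ⟨ha.le.trans hs.1.le, hs.2.le.trans hb⟩
      exact tendsto_nhds_unique (tendsto_const_nhds.congr' hev) (hlim.mul_const _)
    · exact .inl (key a ha h1)
    · exact .inr (key b (ha.trans hab) h2)
  intro r hr
  have hR0 : 0 ≤ R := hr.1.trans hr.2
  have hg0 : g 0 = u x := by
    simp [hg, sphericalMean_zero hm, sphereCoeff_zero hm]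
  have hgr : g r = u x := by
    rcases hr.1.eq_or_lt with h0 | h0
    · rw [← h0, hg0]
    have hRpos : 0 < R := h0.trans_le hr.2
    -- Constancy is known only on `(0, R]`; continuity at `0` identifies the constant as `u x`.
    have hlim : Tendsto g (𝓝[>] 0) (𝓝 (g 0)) := by
      refine ((hgc 0 ⟨le_rfl, hR0⟩).mono_left ?_)
      rw [← nhdsWithin_Ioo_eq_nhdsGT hRpos]
      exact nhdsWithin_mono _ Ioo_subset_Icc_self
    have hev : ∀ᶠ s in 𝓝[>] 0, g r = g s := by
      filter_upwards [Ioo_mem_nhdsGT hRpos] with s hs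
      exact hconst r ⟨h0, hr.2⟩ s ⟨hs.1, hs.2.le⟩
    rw [← hg0]
    exact tendsto_nhds_unique (tendsto_const_nhds.congr' hev) hlim
  rw [← hgr, hg]
  exact (div_mul_cancel₀ _ (hApos r hr).ne').symm

/-- A continuous function with the mean value property for spheres is smooth. -/
lemma contDiffAt_of_sphericalMean (hm : 0 < m) (hD : IsOpen D) (hu : ContinuousOn u D)
    (hρ : 0 < ρ) (hpos : ∀ s, 0 ≤ s → s < ρ → 0 < sphereCoeff m (lam * s))
    (hmean : ∀ x ∈ D, ∀ r, 0 ≤ r → r < ρ → closedBall x r ⊆ D →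
      sphericalMean x r u = u x * sphereCoeff m (lam * r))
    {x₀ : EuclideanSpace ℝ (Fin m)} (hx₀ : x₀ ∈ D) : ContDiffAt ℝ 2 u x₀ := by
  obtain ⟨δ, hδ, hδD⟩ := Metric.isOpen_iff.1 hD x₀ hx₀
  -- With `2 * R < δ`, every closed ball of radius `R` centred in `ball x₀ R` stays inside `D`.
  obtain ⟨R, hR0, hRmin⟩ := exists_between (show 0 < min (δ / 2) ρ by positivity)
  have hRδ : 2 * R < δ := by have := hRmin.trans_le (min_le_left _ _); linarith
  have hRρ : R < ρ := hRmin.trans_le (min_le_right _ _)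
  have hBD : closedBall x₀ (2 * R) ⊆ D := (closedBall_subset_ball hRδ).trans hδD
  -- A profile in `s ^ 2`, so that the radial kernel is smooth at the origin too.
  set k : ℝ → ℝ := fun s => Real.smoothTransition (1 - s ^ 2 / R ^ 2) with hk
  have hkc : Continuous k := Real.smoothTransition.continuous.comp (by fun_prop)
  have hk0 : ∀ s, R ≤ s → k s = 0 := fun s hs => by
    refine Real.smoothTransition.zero_of_nonpos ?_
    rw [sub_nonpos, one_le_div (by positivity)]
    gcongr
  have hkpos : ∀ s, 0 ≤ s → s < R → 0 < k s := fun s hs hsR => by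
    refine Real.smoothTransition.pos_of_pos ?_
    rw [sub_pos, div_lt_one (by positivity)]
    gcongr
  set K : EuclideanSpace ℝ (Fin m) → ℝ := fun y => k ‖y‖ with hK
  have hKsmooth : ContDiff ℝ 2 K :=
    Real.smoothTransition.contDiff.comp (contDiff_const.sub ((contDiff_norm_sq ℝ).div_const _))
  have hKsupp : HasCompactSupport K :=
    HasCompactSupport.intro (isCompact_closedBall 0 R) fun y hy =>
      hk0 _ (by simpa using (not_le.1 fun h => hy (mem_closedBall_zero_iff.2 h)).le)
  -- The cut-off makes `u` globally integrable and is invisible to the convolution at points of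
  -- `ball x₀ R`.
  set v : EuclideanSpace ℝ (Fin m) → ℝ := (closedBall x₀ (2 * R)).indicator u with hv
  have hvint : Integrable v :=
    ((hu.mono hBD).integrableOn_compact (isCompact_closedBall _ _)).integrable_indicator
      measurableSet_closedBall
  have hconv : ContDiff ℝ 2 (convolution K v (ContinuousLinearMap.lsmul ℝ ℝ) volume) :=
    hKsupp.contDiff_convolution_left _ hKsmooth hvint.locallyIntegrable
  set c : ℝ := (m * volume.real (ball (0 : EuclideanSpace ℝ (Fin m)) 1)) *
    ∫ s in 0..R, s ^ (m - 1) * k s * sphereCoeff m (lam * s) with hc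
  have hA : Continuous fun s => sphereCoeff m (lam * s) :=
    (continuous_sphereCoeff hm).comp (by fun_prop)
  have hcpos : 0 < c := by
    refine mul_pos (mul_pos (by positivity) (volume_real_unitBall_pos m)) ?_
    refine intervalIntegral.intervalIntegral_pos_of_pos_on
      (Continuous.intervalIntegrable (by fun_prop) _ _) (fun s hs => ?_) hR0
    have := hkpos s hs.1.le hs.2
    have := hpos s hs.1.le (hs.2.trans hRρ)
    have := hs.1
    positivity
  have hrep : ∀ x ∈ ball x₀ R,
      convolution K v (ContinuousLinearMap.lsmul ℝ ℝ) volume x = c * u x := by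
    intro x hx
    have hsub : closedBall x R ⊆ closedBall x₀ (2 * R) :=
      closedBall_subset_closedBall' (by linarith [mem_ball.1 hx])
    have hxD : x ∈ D := hBD (hsub (mem_closedBall_self hR0.le))
    rw [convolution_eq_swap]
    have h1 : ∀ t, (ContinuousLinearMap.lsmul ℝ ℝ) (K (x - t)) (v t) =
        (ball x R).indicator (fun t => k (dist x t) * u t) t := by
      intro t
      simp only [ContinuousLinearMap.lsmul_apply, smul_eq_mul, hK, ← dist_eq_norm]
      by_cases ht : t ∈ ball x R
      · rw [indicator_of_mem ht, hv, indicator_of_mem (hsub (ball_subset_closedBall ht))]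
      · rw [indicator_of_notMem ht, hk0, zero_mul]
        rw [dist_comm]
        simpa using ht
    simp only [h1]
    rw [integral_indicator measurableSet_ball, ← setIntegral_annulus_zero hm,
      setIntegral_annulus_eq hm hkc le_rfl hR0.le (hu.mono (hsub.trans hBD)), sphereArea_eq, hc,
      mul_assoc _ _ (u x), ← intervalIntegral.integral_mul_const]
    congr 1
    refine intervalIntegral.integral_congr fun s hs => ?_
    rw [uIcc_of_le hR0.le] at hs
    rw [hmean x hxD s hs.1 (hs.2.trans_lt hRρ)
      ((closedBall_subset_closedBall hs.2).trans (hsub.trans hBD))]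
    ring
  refine (contDiff_const.mul hconv : ContDiff ℝ 2 fun x => c⁻¹ *
    convolution K v (ContinuousLinearMap.lsmul ℝ ℝ) volume x).contDiffAt.congr_of_eventuallyEq ?_
  filter_upwards [ball_mem_nhds x₀ hR0] with x hx
  rw [hrep x hx, inv_mul_cancel_left₀ hcpos.ne']

/-- `ballCoeff` is a differentiable function of `r ^ 2`, so the limit is its derivative in that
variable at `0`. -/
lemma tendsto_ballCoeff_sub_one_div_sq (m : ℕ) (lam : ℝ) :
    Tendsto (fun r => (ballCoeff m (lam * r) - 1) / r ^ 2) (𝓝[>] 0)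
      (𝓝 (-(lam ^ 2 / (2 * (m + 2))))) := by
  have hμ : 0 < (m : ℝ) / 2 + 1 := by positivity
  have hΓ := Real.Gamma_pos_of_pos hμ
  have h1 : HasDerivAt (fun y => Real.Gamma ((m : ℝ) / 2 + 1) *
      besselEntire ((m : ℝ) / 2 + 1) (lam ^ 2 / 4 * y)) (-(lam ^ 2 / (2 * (m + 2)))) 0 := by
    have h2 := ((hasDerivAt_besselEntire hμ (lam ^ 2 / 4 * 0)).comp 0
      ((hasDerivAt_id (0 : ℝ)).const_mul (lam ^ 2 / 4))).const_mul (Real.Gamma ((m : ℝ) / 2 + 1))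
    convert! h2 using 1
    rw [mul_zero, besselEntire_zero, Real.Gamma_add_one hμ.ne']
    field_simp
    ring
  have h3 := h1.tendsto_slope_zero
  have h4 : Tendsto (fun r : ℝ => r ^ 2) (𝓝[>] 0) (𝓝[≠] 0) := by
    refine tendsto_nhdsWithin_iff.2 ⟨?_, ?_⟩
    · exact ((continuous_pow 2).tendsto' (0 : ℝ) 0 (by norm_num)).mono_left nhdsWithin_le_nhds
    · filter_upwards [self_mem_nhdsWithin] with r hr
      exact (pow_pos hr 2).ne'
  refine (h3.comp h4).congr fun r => ?_
  simp only [Function.comp, zero_add, mul_zero, besselEntire_zero, smul_eq_mul, ballCoeff]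
  rw [mul_one_div_cancel hΓ.ne', show lam ^ 2 / 4 * r ^ 2 = (lam * r) ^ 2 / 4 by ring,
    div_eq_inv_mul _ (r ^ 2)]

/-- A `C²` function with the mean value property for small spheres solves `Δu + λ²u = 0`. -/
lemma laplacian_add_eq_zero_of_sphericalMean (hm : 0 < m) (hlam : 0 < lam)
    {x : EuclideanSpace ℝ (Fin m)} (hu : ContDiffAt ℝ 2 u x) {R : ℝ} (hR : 0 < R)
    (huc : ContinuousOn u (closedBall x R))
    (hmean : ∀ r ∈ Icc 0 R, sphericalMean x r u = u x * sphereCoeff m (lam * r)) :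
    Laplacian.laplacian u x + lam ^ 2 * u x = 0 := by
  set V := volume.real (ball (0 : EuclideanSpace ℝ (Fin m)) 1) with hV
  have hVpos : 0 < V := volume_real_unitBall_pos m
  set Lu := Laplacian.laplacian u x with hLu
  have hball : ∀ r, 0 < r → r ≤ R →
      ∫ z in ball (0 : EuclideanSpace ℝ (Fin m)) r, u (x + z) =
        V * (r ^ m * ballCoeff m (lam * r)) * u x := by
    intro r hr hrR
    have h1 := setIntegral_annulus_eq hm (k := fun _ => 1) continuous_const le_rfl hr.le
      (huc.mono (closedBall_subset_closedBall hrR))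
    rw [setIntegral_annulus_zero hm, sphereArea_eq] at h1
    simp only [one_mul, mul_one] at h1
    have h2 : ∫ s in 0..r, s ^ (m - 1) * sphericalMean x s u =
        (∫ s in 0..r, s ^ (m - 1) * sphereCoeff m (lam * s)) * u x := by
      rw [← intervalIntegral.integral_mul_const]
      refine intervalIntegral.integral_congr fun s hs => ?_
      rw [uIcc_of_le hr.le] at hs
      rw [hmean s ⟨hs.1, hs.2.trans hrR⟩]
      ring
    have h3 := intervalIntegral_sphereCoeff hm hlam 0 r
    rw [zero_pow hm.ne', zero_mul, sub_zero] at h3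
    have h4 : ∫ z in ball (0 : EuclideanSpace ℝ (Fin m)) r, u (x + z) = ∫ y in ball x r, u y := by
      have h5 := (measurePreserving_add_left volume x).setIntegral_preimage_emb
        (measurableEmbedding_addLeft x) u (ball x r)
      rw [← h5]
      congr 2
      ext z
      simp
    rw [h4, h1, h2, ← h3]
    ring
  -- The Taylor expansion is integrated over the ball of radius `r`: the linear term vanishes, the
  -- quadratic one gives the Laplacian, `hball` evaluates the integral of `u`, and division by `r ^
  -- 2` times the volume leaves the error `ε`.
  have hest : ∀ ε > 0, ∀ᶠ r in 𝓝[>] (0 : ℝ),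
      |(ballCoeff m (lam * r) - 1) / r ^ 2 * u x - Lu / (2 * (m + 2))| ≤ ε := by
    intro ε hε
    obtain ⟨δ, hδ, hδ'⟩ := exists_taylor_two_bound hu hε
    filter_upwards [Ioo_mem_nhdsGT (show 0 < min δ R by positivity)] with r hr
    have hr0 : 0 < r := hr.1
    have hrδ : r < δ := hr.2.trans_le (min_le_left _ _)
    have hrR : r ≤ R := (hr.2.trans_le (min_le_right _ _)).le
    set H := fderiv ℝ (fderiv ℝ u) x with hH
    set B := ball (0 : EuclideanSpace ℝ (Fin m)) r with hB
    have hBvol : volume.real B = r ^ m * V := volume_real_ball 0 hr0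
    have hint : IntegrableOn (fun z => u (x + z)) B := by
      refine IntegrableOn.mono_set (t := closedBall 0 r) ?_ ball_subset_closedBall
      refine ContinuousOn.integrableOn_compact (isCompact_closedBall _ _)
        (huc.comp (by fun_prop) fun z hz => ?_)
      rw [mem_closedBall, dist_self_add_left]
      exact (mem_closedBall_zero_iff.1 hz).trans hrR
    have hbd : |∫ z in B, (u (x + z) - u x - fderiv ℝ u x z - 1 / 2 * H z z)| ≤
        ε * r ^ 2 * (r ^ m * V) := by
      rw [← hBvol, ← Real.norm_eq_abs]
      refine norm_setIntegral_le_of_norm_le_const measure_ball_lt_top fun z hz => ?_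
      have hz' : ‖z‖ < r := mem_ball_zero_iff.1 hz
      refine (hδ' z (hz'.trans hrδ)).trans ?_
      gcongr
    have i1 : IntegrableOn (fun _ : EuclideanSpace ℝ (Fin m) => u x) B :=
      integrableOn_ball_of_continuous continuous_const r
    have i2 : IntegrableOn (fun z => fderiv ℝ u x z) B :=
      integrableOn_ball_of_continuous (by fun_prop) r
    have i3 : IntegrableOn (fun z => 1 / 2 * H z z) B :=
      integrableOn_ball_of_continuous (by fun_prop) r
    rw [integral_sub ((hint.fun_sub i1).fun_sub i2) i3, integral_sub (hint.fun_sub i1) i2,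
      integral_sub hint i1, hball r hr0 hrR, setIntegral_const, hBvol, setIntegral_ball_linear,
      integral_const_mul, setIntegral_ball_bilinear hm H hr0.le, ← laplacian_eq_sum_fderiv,
      smul_eq_mul, sub_zero] at hbd
    have hfac : V * (r ^ m * ballCoeff m (lam * r)) * u x - r ^ m * V * u x -
        1 / 2 * (Lu * (V * (r ^ (m + 2) / (m + 2)))) =
        r ^ 2 * (r ^ m * V) *
          ((ballCoeff m (lam * r) - 1) / r ^ 2 * u x - Lu / (2 * (m + 2))) := by
      field_simp
      ring
    rw [hfac, abs_mul, abs_of_pos (by positivity), mul_assoc ε, mul_comm ε] at hbd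
    refine le_of_mul_le_mul_left ?_ (show 0 < r ^ 2 * (r ^ m * V) by positivity)
    linarith
  have hlim := ((tendsto_ballCoeff_sub_one_div_sq m lam).mul_const (u x)).sub_const
    (Lu / (2 * (m + 2)))
  have hzero : -(lam ^ 2 / (2 * (m + 2))) * u x - Lu / (2 * (m + 2)) = 0 := by
    refine abs_eq_zero.1 (le_antisymm (le_of_forall_pos_le_add fun ε hε => ?_) (abs_nonneg _))
    rw [zero_add]
    exact le_of_tendsto hlim.abs (hest ε hε)
  have hm2 : (0 : ℝ) < 2 * (m + 2) := by positivity
  field_simp at hzero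
  linarith

end MeanValue

end Metaharmonic

theorem theorem4p4 (m : ℕ) (hm : 2 ≤ m) (D : Set (EuclideanSpace ℝ (Fin m)))
    (hDopen : IsOpen D) (hDconn : IsConnected D) (hDbdd : Bornology.IsBounded D)
    (lam : ℝ) (hlam : 0 < lam)
    (u : EuclideanSpace ℝ (Fin m) → ℝ) (hu : ContinuousOn u D)
    (h : ∀ x ∈ D, ∀ r₁ r₂ : ℝ, 0 < r₁ → r₁ < r₂ →
      r₂ < Metaharmonic.besselFirstZero (((m : ℝ) - 2) / 2) / lam →
      Metric.closedBall x r₂ ⊆ D →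
      (∀ r ∈ Set.Ioo r₁ r₂, Metaharmonic.AnnularIdentity lam u x r₁ r₂ r) ∨
        Metaharmonic.AnnularIdentity lam u x r₁ r₂ r₁ ∨
        Metaharmonic.AnnularIdentity lam u x r₁ r₂ r₂) :
    Metaharmonic.IsMetaharmonicOn lam u D := by
  have hm0 : 0 < m := by omega
  have hj := Metaharmonic.besselFirstZero_pos hm0
  have hmean : ∀ x ∈ D, ∀ R, R < Metaharmonic.besselFirstZero (((m : ℝ) - 2) / 2) / lam →
      Metric.closedBall x R ⊆ D → ∀ r ∈ Set.Icc 0 R,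
      Metaharmonic.sphericalMean x r u = u x * Metaharmonic.sphereCoeff m (lam * r) :=
    fun x hx R hR hRD => Metaharmonic.sphericalMean_eq_of_annularIdentity hm0 hlam hR
      (hu.mono hRD) fun r₁ r₂ h₁ h₁₂ h₂ => h x hx r₁ r₂ h₁ h₁₂ (h₂.trans_lt hR)
        ((Metric.closedBall_subset_closedBall h₂).trans hRD)
  have hsmooth : ∀ x ∈ D, ContDiffAt ℝ 2 u x := fun x hx =>
    Metaharmonic.contDiffAt_of_sphericalMean hm0 hDopen hu (div_pos hj hlam)
      (fun s hs hsρ => Metaharmonic.sphereCoeff_pos hm0 (mul_nonneg hlam.le hs)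
        (by rw [mul_comm]; exact (lt_div_iff₀ hlam).1 hsρ))
      (fun y hy r hr hrρ hrD => hmean y hy r hrρ hrD r ⟨hr, le_rfl⟩) hx
  refine ⟨fun x hx => (hsmooth x hx).contDiffWithinAt, fun x hx => ?_⟩
  obtain ⟨δ, hδ, hδD⟩ := Metric.isOpen_iff.1 hDopen x hx
  obtain ⟨R, hR0, hRmin⟩ := exists_between (lt_min hδ (div_pos hj hlam))
  have hRD : Metric.closedBall x R ⊆ D :=
    (Metric.closedBall_subset_ball (hRmin.trans_le (min_le_left _ _))).trans hδD
  exact Metaharmonic.laplacian_add_eq_zero_of_sphericalMean hm0 hlam (hsmooth x hx) hR0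
    (hu.mono hRD) (hmean x hx R (hRmin.trans_le (min_le_right _ _)) hRD)
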